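/- Let $\mathcal I$ (agents) and $\mathcal P$ (components) be finite sets, and let $y=\mathrm{col}((y_p)_{p\in\mathcal P})$ with $y_p\in\mathbb R^{n_p}$. Let $\mathcal E^{\mathrm I}\subseteq\mathcal E^{\mathrm E}\subseteq\mathcal P\times\mathcal I$ be the edge sets of the interference graph and of the estimate graph, and assume that every $p\in\mathcal P$ has at least one edge $(p,i)\in\mathcal E^{\mathrm I}$. Write $\mathcal N^{\mathrm I}_i=\{p:(p,i)\in\mathcal E^{\mathrm I}\}$, $\mathcal N^{\mathrm E}_i=\{p:(p,i)\in\mathcal E^{\mathrm E}\}$ and $\mathcal N_p=\{i:(p,i)\in\mathcal E^{\mathrm E}\}$. Each agent $i$ has a cost $f_i:\prod_{p\in\mathcal N^{\mathrm I}_i}\mathbb R^{n_p}\to\mathbb R$, also regarded as a function of $y$, or of $(y_p)_{p\in\mathcal N^{\mathrm E}_i}$, that depends only on the components $y_p$, $p\in\mathcal N^{\mathrm I}_i$. Assume that the set $\mathcal Y^\star$ of minimizers of $f(y)=\sum_{i\in\mathcal I}f_i(y)$ over $y\in\prod_{p\in\mathcal P}\mathbb R^{n_p}$ is nonempty. The agents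 communicate over time-varying directed graphs $\mathcal C^k$ on $\mathcal I$, $k\in\mathbb N=\{0,1,2,\dots\}$. For each $p$ and $k$ let $\mathcal G_p^k=(\mathcal N_p,\mathcal E_p^k)$ be a directed graph (the design graph) that is a subgraph of $\mathcal C^k$, with a weight matrix $W_p^k\in\mathbb R^{\mathcal N_p\times\mathcal N_p}$ such that $[W_p^k]_{i,j}>0$ if $(j,i)\in\mathcal E_p^k$ (agent $i$ receives from agent $j$) and $[W_p^k]_{i,j}=0$ otherwise. Assume that there are $\nu>0$ and an integer $Q>0$ such that, for all $k$ and $p$: (i) $(i,i)\in\mathcal E_p^k$ for all $i\in\mathcal N_p$; (ii) every column of $W_p^k$ sums to $1$; (iii) $[W_p^k]_{i,j}\ge\nu$ for all $(j,i)\in\mathcal E_p^k$; (iv) the graph $\bigcup_{t=kQ}^{(k+1)Q-1}\mathcal G_p^t$ is strongly connected. Consider sequences satisfying, for all $k\in\mathbb N$, $i\in\mathcal I$ and $p\in\mathcal N^{\mathrm E}_i$, $$q_{i,p}^{k+1}=\sum_{j\in\mathcal N_p}[W_p^k]_{i,j}\,q_{j,p}^k,\qquad w_{i,p}^{k+1}=\sum_{j\in\mathcal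 N_p}[W_p^k]_{i,j}\,z_{j,p}^k,\qquad y_{i,p}^{k+1}=\frac{w_{i,p}^{k+1}}{q_{i,p}^{k+1}},\qquad z_{i,p}^{k+1}=w_{i,p}^{k+1}-\gamma^k g_{i,p}^{k+1},$$ where $q_{i,p}^0=1$, $z_{i,p}^0\in\mathbb R^{n_p}$ is arbitrary, and, for each $i$, $(g_{i,p}^{k+1})_{p\in\mathcal N^{\mathrm E}_i}$ is a subgradient of $f_i$, as a function of $(y_p)_{p\in\mathcal N^{\mathrm E}_i}$, at the point $(y_{i,p}^{k+1})_{p\in\mathcal N^{\mathrm E}_i}$. Assume that every $f_i$ is convex and that there is $L>0$ such that $\|g_i\|\le L$ for all $i\in\mathcal I$, all $y$ and all $g_i\in\partial_y f_i(y)$. Let $(\gamma^k)_{k\in\mathbb N}$ be positive and non-increasing with $\sum_{k=0}^\infty\gamma^k=\infty$ and $\sum_{k=0}^\infty(\gamma^k)^2<\infty$. Then there is $y^\star\in\mathcal Y^\star$ such that $y_{i,p}^k\to y_p^\star$ as $k\to\infty$ for all $p\in\mathcal P$ and $i\in\mathcal N_p$; that is, the estimates converge to $\boldsymbol{\mathcal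 E}(y^\star)$, the vector all of whose copies of the component $p$ equal $y_p^\star$. -/

import Mathlib

open Filter Topology

noncomputable section

namespace PushSum

/-! ### Graphs -/

section Graphs

variable {V : Type*}

/-- A directed graph is strongly connected if there is a path from `u` to `v`, for all vertices
`u`, `v`. -/
def IsStronglyConnected (G : Digraph V) : Prop :=
  ∀ u v : V, Relation.ReflTransGen G.Adj u v

/-- `Q`-strong connectivity of a time-varying graph: the union of the graphs over each window
`{kQ, …, (k+1)Q - 1}` is strongly connected. -/
def IsQStronglyConnected (Q : ℕ) (G : ℕ → Digraph V) : Prop :=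
  ∀ k : ℕ, IsStronglyConnected (⨆ t ∈ Set.Ico (k * Q) ((k + 1) * Q), G t)

/-- Weights compliant with a directed graph: the entry in row `u` and column `v` is positive if
`(v, u)` is an edge (that is, if `u` receives information from `v`), and zero otherwise. -/
def IsCompliant (G : Digraph V) (W : Matrix V V ℝ) : Prop :=
  ∀ u v : V, (G.Adj v u → 0 < W u v) ∧ (¬ G.Adj v u → W u v = 0)

end Graphs

/-! ### Bipartite graphs between components and agents

A bipartite graph from components (type `π`) to agents (type `ι`) is its finite set of edges
`E ⊆ π × ι`. -/

section Bipartite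

variable {π ι : Type*} [DecidableEq π] [DecidableEq ι]

/-- The out-neighbors of the component `p`. -/
def outNbr [Fintype ι] (E : Finset (π × ι)) (p : π) : Finset ι := Finset.univ.filter fun i => (p, i) ∈ E

/-- The in-neighbors of the agent `i`. -/
def inNbr [Fintype π] (E : Finset (π × ι)) (i : ι) : Finset π := Finset.univ.filter fun p => (p, i) ∈ E

theorem mem_outNbr_iff_mem_inNbr [Fintype π] [Fintype ι] {E : Finset (π × ι)} {p : π} {i : ι} :
    i ∈ outNbr E p ↔ p ∈ inNbr E i := by
  simp [outNbr, inNbr]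

theorem inNbr_mono [Fintype π] {E F : Finset (π × ι)} (h : E ⊆ F) (i : ι) : inNbr E i ⊆ inNbr F i := by
  intro p hp
  simp only [inNbr, Finset.mem_filter, Finset.mem_univ, true_and] at hp ⊢
  exact h hp

end Bipartite

/-! ### The variable of interest and its copies -/

section Variables

variable {π ι : Type*} [Fintype π] [DecidableEq π] [Fintype ι] [DecidableEq ι]

/-- The Euclidean space of the full variable `y = col((y_p)_p)`, where `y_p ∈ ℝ^{n p}`. -/
abbrev Var (n : π → ℕ) : Type _ := PiLp 2 fun p : π => EuclideanSpace ℝ (Fin (n p))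

/-- The Euclidean space of the stacked components `col((y_p)_{p ∈ S})`. -/
abbrev SubVar (n : π → ℕ) (S : Finset π) : Type _ :=
  PiLp 2 fun p : {p : π // p ∈ S} => EuclideanSpace ℝ (Fin (n p))

/-- The components `(y_p)_{p ∈ S}` of a full variable. -/
def Var.restrict {n : π → ℕ} (S : Finset π) (y : Var n) : SubVar n S :=
  WithLp.toLp 2 fun p => y p

/-- The components in `S` of a vector with components in `T ⊇ S`. -/
def SubVar.restrict {n : π → ℕ} {S T : Finset π} (h : S ⊆ T) (y : SubVar n T) : SubVar n S :=
  WithLp.toLp 2 fun p => y ⟨p, h p.2⟩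

/-- Families with one vector of `ℝ^{n p}` for each component `p` and each agent `i` that keeps an
estimate of `y_p`. -/
abbrev Copies (n : π → ℕ) (E : Finset (π × ι)) : Type _ :=
  ∀ p : π, {i : ι // i ∈ outNbr E p} → EuclideanSpace ℝ (Fin (n p))

/-- All the vectors kept by the agent `i`, stacked. -/
def Copies.agent {n : π → ℕ} {E : Finset (π × ι)} (x : Copies n E) (i : ι) :
    SubVar n (inNbr E i) :=
  WithLp.toLp 2 fun p => x p ⟨i, mem_outNbr_iff_mem_inNbr.2 p.2⟩

/-- The family in which every copy of the component `p` equals `y_p`. -/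
def consensus {n : π → ℕ} (E : Finset (π × ι)) (y : Var n) : Copies n E :=
  fun p _ => y p

end Variables

/-! ### The optimization problem -/

section Optimization

/-- The subdifferential of a real-valued function. -/
def subdifferential {X : Type*} [NormedAddCommGroup X] [InnerProductSpace ℝ X] (ψ : X → ℝ)
    (x : X) : Set X :=
  {v | ∀ z : X, ψ x + inner ℝ v (z - x) ≤ ψ z}

variable {π ι : Type*} [Fintype π] [DecidableEq π] [Fintype ι] [DecidableEq ι]
variable {n : π → ℕ} {Intf : Finset (π × ι)}

/-- The cost `f_i((y_p)_{p ∈ inNbr Intf i})` of the agent `i`, as a function of the full variable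
`y`. -/
def fullCost (f : ∀ i : ι, SubVar n (inNbr Intf i) → ℝ) (i : ι) (y : Var n) : ℝ :=
  f i (y.restrict (inNbr Intf i))

/-- The cost of the agent `i`, as a function of the components that `i` estimates. -/
def estCost (f : ∀ i : ι, SubVar n (inNbr Intf i) → ℝ) {E : Finset (π × ι)} (h : Intf ⊆ E)
    (i : ι) (x : SubVar n (inNbr E i)) : ℝ :=
  f i (SubVar.restrict (inNbr_mono h i) x)

/-- The total cost `∑ i, f_i`. -/
def totalCost (f : ∀ i : ι, SubVar n (inNbr Intf i) → ℝ) (y : Var n) : ℝ :=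
  ∑ i, fullCost f i y

/-- The set of minimizers of the total cost. -/
def solutionSet (f : ∀ i : ι, SubVar n (inNbr Intf i) → ℝ) : Set (Var n) :=
  {y | ∀ y' : Var n, totalCost f y ≤ totalCost f y'}

/-! ### The algorithm -/

/-- The sequences `q`, `w`, `z`, `y`, `g` are generated by the push-sum subgradient method with
weights `W` and step sizes `γ`, from an arbitrary `z 0`. For each agent, the vectors `g (k+1) p i`,
over the components `p` that the agent `i` estimates, are the blocks of one subgradient of its
cost. The values `w 0`, `y 0`, `g 0` play no role. -/
structure IsRun (f : ∀ i : ι, SubVar n (inNbr Intf i) → ℝ) {E : Finset (π × ι)} (hE : Intf ⊆ E)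
    (W : ℕ → ∀ p : π, Matrix {i : ι // i ∈ outNbr E p} {i : ι // i ∈ outNbr E p} ℝ)
    (γ : ℕ → ℝ) (q : ℕ → ∀ p : π, {i : ι // i ∈ outNbr E p} → ℝ)
    (w z y g : ℕ → Copies n E) : Prop where
  q_zero : ∀ p i, q 0 p i = 1
  q_succ : ∀ k p i, q (k + 1) p i = ∑ j, W k p i j * q k p j
  w_succ : ∀ k p i, w (k + 1) p i = ∑ j, W k p i j • z k p j
  y_succ : ∀ k p i, y (k + 1) p i = (q (k + 1) p i)⁻¹ • w (k + 1) p i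
  g_succ : ∀ k i, (g (k + 1)).agent i ∈ subdifferential (estCost f hE i) ((y (k + 1)).agent i)
  z_succ : ∀ k p i, z (k + 1) p i = w (k + 1) p i - γ k • g (k + 1) p i

end Optimization

end PushSum

end

/-! For each component `p`, push-sum is analysed through the average `a k p` of the vectors `z k p`.
Columns sum to one, so mixing preserves this average, and each iteration moves it by exactly `-γ k`
times the average of the subgradients. The averages thus follow a subgradient method whose
subgradients are taken at the estimates instead of at `a k`.

Consensus: dividing by `q` turns the column-stochastic products into row-stochastic ones. The ratios
`z / q` after `T` steps are convex combinations of the earlier ratios, with weights bounded below,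
plus an error of order `γ k`. Their diameter contracts, and hence is square-summable because `γ` is;
it bounds the distance from the estimates to the average (`exists_summable_sq_norm_sub_average_le`).

Optimality: in the squared distance weighted by the number of copies, the factors `1 / N_p` cancel,
and the subgradients of all agents add up to a step for the total cost (`copiesDistSq_le`).
Evaluating them at the estimates costs `2 * L` times the consensus error
(`fullCost_sub_fullCost_le`); multiplied by `γ k`, this is summable, being a product of
square-summable sequences. The averages are therefore quasi-Fejér with respect to the minimizers and
converge to one of them (`exists_tendsto_minimizer`); the estimates follow. -/

namespace PushSum

/-! ### Real sequences -/

/-- A nonnegative sequence that contracts over `T` steps up to a summable error is summable. -/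
theorem summable_of_contraction {s b : ℕ → ℝ} {T : ℕ} {ε : ℝ} (hε : 0 < ε) (hs : ∀ k, 0 ≤ s k)
    (hb : ∀ k, 0 ≤ b k) (hbs : Summable b) (h : ∀ k, s (k + T) ≤ (1 - ε) * s k + b k) :
    Summable s := by
  -- Summing the hypothesis over `k < K`, the shifted sum misses only the first `T` terms, so `ε`
  -- times the partial sum is at most those terms plus the total error.
  refine summable_of_sum_range_le (c := ((∑ k ∈ Finset.range T, s k) + ∑' k, b k) / ε) hs
    fun K => ?_
  rw [le_div_iff₀ hε]
  have h1 : ∑ k ∈ Finset.range K, s k ≤ ∑ k ∈ Finset.range (T + K), s k :=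
    Finset.sum_le_sum_of_subset_of_nonneg (by simp) fun k _ _ => hs k
  rw [Finset.sum_range_add] at h1
  have h2 : ∑ k ∈ Finset.range K, s (T + k) ≤
      ∑ k ∈ Finset.range K, ((1 - ε) * s k + b k) :=
    Finset.sum_le_sum fun k _ => by rw [add_comm T k]; exact h k
  rw [Finset.sum_add_distrib, ← Finset.mul_sum] at h2
  have h3 := hbs.sum_le_tsum (Finset.range K) fun k _ => hb k
  linarith

/-- A nonnegative sequence that contracts over `T` steps up to a square-summable error is
square-summable. -/
theorem summable_sq_of_contraction {s b : ℕ → ℝ} {T : ℕ} {ε : ℝ} (hε : 0 < ε) (hε1 : ε ≤ 1)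
    (hs : ∀ k, 0 ≤ s k) (hbs : Summable fun k => b k ^ 2)
    (h : ∀ k, s (k + T) ≤ (1 - ε) * s k + b k) : Summable fun k => s k ^ 2 := by
  refine summable_of_contraction (b := fun k => b k ^ 2 / ε) (T := T) hε (fun k => sq_nonneg _)
    (fun k => div_nonneg (sq_nonneg _) hε.le) (hbs.div_const ε) fun k => ?_
  have h1 : s (k + T) ^ 2 ≤ ((1 - ε) * s k + b k) ^ 2 := by
    gcongr
    · exact hs _
    · exact h k
  -- Convexity of the square at `(1 - ε) * s k + ε * (b k / ε)`, with its exact defect.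
  have h2 : (1 - ε) * s k ^ 2 + b k ^ 2 / ε - ((1 - ε) * s k + b k) ^ 2
      = (1 - ε) / ε * (ε * s k - b k) ^ 2 := by
    field_simp
    ring
  have h3 : 0 ≤ (1 - ε) / ε * (ε * s k - b k) ^ 2 :=
    mul_nonneg (div_nonneg (by linarith) hε.le) (sq_nonneg _)
  linarith

/-- A real sequence that is bounded below and decreases up to a summable error converges. -/
theorem exists_tendsto_of_le_add {v b : ℕ → ℝ} (hv : ∀ k, 0 ≤ v k)
    (hb : Summable b) (h : ∀ k, v (k + 1) ≤ v k + b k) : ∃ l, Tendsto v atTop (𝓝 l) := by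
  have hB := hb.hasSum.tendsto_sum_nat
  -- Subtracting the accumulated errors makes the sequence monotone.
  have hanti : Antitone fun k => v k - ∑ s ∈ Finset.range k, b s :=
    antitone_nat_of_succ_le fun k => by
      rw [Finset.sum_range_succ]; linarith [h k]
  obtain ⟨C, hC⟩ := hB.bddAbove_range
  have hbd : BddBelow (Set.range fun k => v k - ∑ s ∈ Finset.range k, b s) := by
    refine ⟨-C, ?_⟩
    rintro _ ⟨k, rfl⟩
    have := hC ⟨k, rfl⟩
    dsimp only at this ⊢
    linarith [hv k]
  have := (tendsto_atTop_ciInf hanti hbd).add hB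
  exact ⟨_, by simpa using this⟩

/-- If `v` decreases by `γ k * φ k` up to a summable error and `γ` is not summable, then `φ` is
frequently arbitrarily small. -/
theorem frequently_lt_of_le_sub_add {v b γ φ : ℕ → ℝ} (hv : ∀ k, 0 ≤ v k) (hb : Summable b)
    (hγ : ∀ k, 0 ≤ γ k) (hγs : ¬ Summable γ)
    (h : ∀ k, v (k + 1) ≤ v k - γ k * φ k + b k) {ε : ℝ} (hε : 0 < ε) :
    ∃ᶠ k in atTop, φ k < ε := by
  intro hcon
  simp only [not_lt] at hcon
  obtain ⟨K, hK⟩ := eventually_atTop.1 hcon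
  refine hγs ((summable_nat_add_iff K).1 ?_)
  have hbK : Summable fun k => b (k + K) := (summable_nat_add_iff K).2 hb
  obtain ⟨C, hC⟩ := hbK.hasSum.tendsto_sum_nat.bddAbove_range
  refine summable_of_sum_range_le (c := (v K + C) / ε) (fun k => hγ _) fun n => ?_
  have key : ∀ n, v (n + K) ≤ v K - ε * ∑ k ∈ Finset.range n, γ (k + K)
      + ∑ k ∈ Finset.range n, b (k + K) := by
    intro n
    induction n with
    | zero => simp
    | succ n ih =>
      rw [Finset.sum_range_succ, Finset.sum_range_succ, Nat.add_right_comm]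
      have h1 := h (n + K)
      have h2 := mul_le_mul_of_nonneg_left (hK (n + K) (by omega)) (hγ (n + K))
      linarith
  have h1 := key n
  have h2 := hC ⟨n, rfl⟩
  dsimp only at h2
  rw [le_div_iff₀ hε]
  linarith [hv (n + K)]

/-- Convergence of a sequence that is quasi-Fejér monotone with respect to the minimizers of a
continuous function, with the squared distance replaced by a function `V` that dominates it. -/
theorem exists_tendsto_minimizer {X : Type*} [NormedAddCommGroup X] [ProperSpace X]
    {F : X → ℝ} (hF : Continuous F) {S : Set X} (hS : S = {c | ∀ x, F c ≤ F x})
    (hne : S.Nonempty) {V : X → X → ℝ} (hVc : ∀ c, Continuous (V c)) (hV0 : ∀ c, V c c = 0)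
    (hVd : ∀ c x, ‖x - c‖ ^ 2 ≤ V c x) {x : ℕ → X} {γ b : ℕ → ℝ} (hb : Summable b)
    (hγ : ∀ k, 0 ≤ γ k) (hγs : ¬ Summable γ)
    (h : ∀ c ∈ S, ∀ k, V c (x (k + 1)) ≤ V c (x k) - γ k * (F (x k) - F c) + b k) :
    ∃ c ∈ S, Tendsto x atTop (𝓝 c) := by
  subst hS
  obtain ⟨c₀, hc₀⟩ := hne
  have hVn : ∀ c y, 0 ≤ V c y := fun c y => (sq_nonneg _).trans (hVd c y)
  have hconv : ∀ c ∈ {c | ∀ x, F c ≤ F x}, ∃ l, Tendsto (fun k => V c (x k)) atTop (𝓝 l) := by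
    intro c hc
    refine exists_tendsto_of_le_add (fun k => hVn _ _) hb fun k => ?_
    have := mul_nonneg (hγ k) (sub_nonneg.2 (hc (x k)))
    linarith [h c hc k]
  -- Non-summability of `γ` gives a subsequence along which `F` tends to its minimum; boundedness
  -- then gives a cluster point that is a minimizer.
  obtain ⟨φ, hφ, hφF⟩ := extraction_forall_of_frequently
    (P := fun n k => F (x k) - F c₀ < 1 / ((n : ℝ) + 1)) fun n =>
      frequently_lt_of_le_sub_add (v := fun k => V c₀ (x k)) (fun k => hVn _ _) hb hγ hγs
        (h c₀ hc₀) (by positivity)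
  obtain ⟨l₀, hl₀⟩ := hconv c₀ hc₀
  obtain ⟨C, hC⟩ := hl₀.bddAbove_range
  have hbd : Bornology.IsBounded (Set.range x) := by
    refine (Metric.isBounded_closedBall (x := c₀) (r := C + 1)).subset ?_
    rintro _ ⟨k, rfl⟩
    rw [mem_closedBall_iff_norm]
    have h1 := hC ⟨k, rfl⟩
    have h2 := hVd c₀ (x k)
    dsimp only at h1
    nlinarith [sq_nonneg (‖x k - c₀‖ - 1), norm_nonneg (x k - c₀)]
  obtain ⟨c, -, ψ, hψ, hlim⟩ := tendsto_subseq_of_bounded hbd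
    (x := fun n => x (φ n)) fun n => ⟨_, rfl⟩
  have hFc : F c ≤ F c₀ := by
    have h1 : Tendsto (fun n => F (x (φ (ψ n)))) atTop (𝓝 (F c)) := (hF.tendsto c).comp hlim
    have h2 : Tendsto (fun n => F c₀ + 1 / ((ψ n : ℝ) + 1)) atTop (𝓝 (F c₀ + 0)) :=
      tendsto_const_nhds.add (tendsto_one_div_add_atTop_nhds_zero_nat.comp hψ.tendsto_atTop)
    rw [add_zero] at h2
    exact le_of_tendsto_of_tendsto' h1 h2 fun n => by linarith [hφF (ψ n)]
  have hcS : c ∈ {c | ∀ x, F c ≤ F x} := fun y => hFc.trans (hc₀ y)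
  refine ⟨c, hcS, ?_⟩
  -- The cluster point is itself in `S`, so `V c` converges along the whole sequence; the
  -- subsequence shows that its limit is zero.
  obtain ⟨l, hl⟩ := hconv c hcS
  have hl1 : Tendsto (fun n => V c (x (φ (ψ n)))) atTop (𝓝 l) :=
    hl.comp (hφ.tendsto_atTop.comp hψ.tendsto_atTop)
  have hl2 : Tendsto (fun n => V c (x (φ (ψ n)))) atTop (𝓝 (V c c)) :=
    ((hVc c).tendsto c).comp hlim
  rw [tendsto_nhds_unique hl1 hl2, hV0] at hl
  have h3 : Tendsto (fun k => ‖x k - c‖ ^ 2) atTop (𝓝 0) :=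
    squeeze_zero (fun k => sq_nonneg _) (fun k => hVd c _) hl
  rw [tendsto_iff_norm_sub_tendsto_zero]
  simpa using h3.sqrt

/-! ### Subgradients of convex functions -/

/-- A continuous convex function has a subgradient at every point. -/
theorem subdifferential_nonempty {X : Type*} [NormedAddCommGroup X] [InnerProductSpace ℝ X]
    [CompleteSpace X] {ψ : X → ℝ} (hψ : ConvexOn ℝ Set.univ ψ) (hc : Continuous ψ) (x : X) :
    (subdifferential ψ x).Nonempty := by
  have hopen : IsOpen {p : X × ℝ | p.1 ∈ Set.univ ∧ ψ p.1 < p.2} := by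
    simpa using isOpen_lt (hc.comp continuous_fst) continuous_snd
  obtain ⟨l, hl⟩ := geometric_hahn_banach_open_point hψ.convex_strict_epigraph hopen
    (x := (x, ψ x)) (by simp)
  have hsplit : ∀ (v : X) (t : ℝ), l (v, t) = l (v, 0) + t * l (0, 1) := by
    intro v t
    have : (v, t) = (v, (0 : ℝ)) + t • ((0 : X), (1 : ℝ)) := by simp
    rw [this, map_add, map_smul, smul_eq_mul]
  -- The separating hyperplane is not vertical, since the epigraph contains a point straight above
  -- `(x, ψ x)`.
  have hneg : l (0, 1) < 0 := by
    have := hl (x, ψ x + 1) (by simp)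
    rw [hsplit x, hsplit x (ψ x)] at this
    linarith
  have hle : ∀ z, l (z, 0) + ψ z * l (0, 1) ≤ l (x, 0) + ψ x * l (0, 1) := by
    intro z
    refine le_of_forall_pos_le_add fun ε hε => ?_
    have hδ : 0 < ε / -l (0, 1) := div_pos hε (neg_pos.2 hneg)
    have := hl (z, ψ z + ε / -l (0, 1)) (by simpa using hδ)
    rw [hsplit z, hsplit x] at this
    have h2 : ε / -l (0, 1) * l (0, 1) = -ε := by
      have := hneg.ne
      field_simp
    linarith
  let m : X →L[ℝ] ℝ := (-l (0, 1))⁻¹ • l.comp (ContinuousLinearMap.inl ℝ X ℝ)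
  refine ⟨(InnerProductSpace.toDual ℝ X).symm m, fun z => ?_⟩
  rw [InnerProductSpace.toDual_symm_apply]
  have hm : m (z - x) = (-l (0, 1))⁻¹ * (l (z, 0) - l (x, 0)) := by
    simp [m, ← map_sub]
  rw [hm, ← le_sub_iff_add_le', inv_mul_le_iff₀ (neg_pos.2 hneg)]
  linarith [hle z]

end PushSum

namespace PushSum

/-! ### Spread of information over strongly connected windows -/

section Reachability

variable {V : Type*} [Fintype V]

/-- The vertices informed by a time-varying graph with self-loops: if every window of length `Q`
is strongly connected, then a nonempty set that is closed under the edges of the successive graphs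
becomes the whole vertex set after `(card V + 1) * Q` steps. -/
theorem eq_univ_of_isQStronglyConnected {Q : ℕ} (hQ : 0 < Q) {G : ℕ → Digraph V}
    (hG : IsQStronglyConnected Q G) (hloop : ∀ k i, (G k).Adj i i) {k : ℕ} {S : ℕ → Finset V}
    (hne : (S k).Nonempty)
    (hS : ∀ t, k ≤ t → ∀ i j, i ∈ S t → (G t).Adj i j → j ∈ S (t + 1)) :
    S (k + (Fintype.card V + 1) * Q) = Finset.univ := by
  classical
  have hstep : ∀ t, k ≤ t → S t ⊆ S (t + 1) := fun t ht i hi => hS t ht i i hi (hloop t i)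
  have hmono : ∀ s t, k ≤ s → s ≤ t → S s ⊆ S t := by
    intro s t hs hst
    induction t, hst using Nat.le_induction with
    | base => exact Finset.Subset.refl _
    | succ t hst ih => exact ih.trans (hstep t (hs.trans hst))
  -- The windows start at multiples of `Q`. Waiting for the next one costs at most `Q` steps, which
  -- is the extra `1` in `card V + 1`.
  obtain ⟨m, hm1, hm2⟩ : ∃ m, k ≤ m * Q ∧ m * Q ≤ k + Q := by
    refine ⟨k / Q + 1, ?_, ?_⟩
    · have := Nat.div_add_mod k Q
      have := Nat.mod_lt k hQ
      rw [add_mul, mul_comm (k / Q)]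
      omega
    · have := Nat.div_mul_le_self k Q
      rw [add_mul]
      omega
  have hgrow : ∀ r, S ((m + r) * Q) = Finset.univ ∨ r + 1 ≤ (S ((m + r) * Q)).card := by
    intro r
    have hk : ∀ r, k ≤ (m + r) * Q := fun r =>
      hm1.trans (Nat.mul_le_mul_right Q (Nat.le_add_right m r))
    induction r with
    | zero => exact Or.inr (Finset.card_pos.2 (hne.mono (hmono _ _ le_rfl (hk 0))))
    | succ r ih =>
      have hle : (m + r) * Q ≤ (m + (r + 1)) * Q := Nat.mul_le_mul_right Q (by omega)
      have hsub := hmono _ _ (hk r) hle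
      by_cases huniv : S ((m + r) * Q) = Finset.univ
      · exact Or.inl (Finset.univ_subset_iff.1 (huniv ▸ hsub))
      right
      have hcard := ih.resolve_left huniv
      obtain ⟨u, hu⟩ := hne.mono (hmono _ _ le_rfl (hk r))
      obtain ⟨v, hv⟩ : ∃ v, v ∉ S ((m + r) * Q) := by
        by_contra! h
        exact huniv (Finset.eq_univ_iff_forall.2 h)
      -- If no edge of the window left the informed set, no path from `u` could reach `v`.
      obtain ⟨a, c, ha, hc, hac⟩ : ∃ a c, a ∈ S ((m + r) * Q) ∧ c ∉ S ((m + r) * Q) ∧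
          (⨆ t ∈ Set.Ico ((m + r) * Q) ((m + r + 1) * Q), G t).Adj a c := by
        by_contra! h
        have hall : ∀ c, Relation.ReflTransGen
            (⨆ t ∈ Set.Ico ((m + r) * Q) ((m + r + 1) * Q), G t).Adj u c →
              c ∈ S ((m + r) * Q) := by
          intro c hc
          induction hc with
          | refl => exact hu
          | tail _ hbc ih =>
            by_contra hcc
            exact h _ _ ih hcc hbc
        exact hv (hall v (hG (m + r) u v))
      simp only [Digraph.iSup_adj] at hac
      obtain ⟨t, ⟨ht1, ht2⟩, hadj⟩ := hac
      have hct : c ∈ S ((m + (r + 1)) * Q) :=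
        hmono (t + 1) _ (by have := hk r; omega) (by rw [← add_assoc]; omega)
          (hS t ((hk r).trans ht1) a c (hmono _ _ (hk r) ht1 ha) hadj)
      exact Nat.lt_of_le_of_lt hcard
        (Finset.card_lt_card ⟨hsub, fun h => hc (h hct)⟩)
  have hfin : S ((m + Fintype.card V) * Q) = Finset.univ := by
    rcases hgrow (Fintype.card V) with h | h
    · exact h
    · have := Finset.card_le_univ (S ((m + Fintype.card V) * Q))
      omega
  refine Finset.univ_subset_iff.1 (hfin ▸ hmono _ _ ?_ ?_)
  · exact hm1.trans (Nat.mul_le_mul_right Q (Nat.le_add_right _ _))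
  · rw [add_mul, add_mul]; omega

end Reachability

/-! ### Products of column-stochastic matrices -/

section Mixing

variable {V : Type*} [Fintype V] [DecidableEq V]

/-- The product `W (k + t - 1) ⬝ ⋯ ⬝ W k`. -/
def transition (W : ℕ → Matrix V V ℝ) (k : ℕ) : ℕ → Matrix V V ℝ
  | 0 => 1
  | t + 1 => W (k + t) * transition W k t

theorem transition_succ_apply (W : ℕ → Matrix V V ℝ) (k t : ℕ) (i j : V) :
    transition W k (t + 1) i j = ∑ l, W (k + t) i l * transition W k t l j := rfl

/-- Column-stochastic matrices with diagonal bounded below by `ν`, such that the entries of the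
products of `T` successive matrices are bounded below by `ν ^ T`. -/
structure IsMixing (W : ℕ → Matrix V V ℝ) (ν : ℝ) (T : ℕ) : Prop where
  pos : 0 < ν
  nonneg : ∀ k i j, 0 ≤ W k i j
  col : ∀ k j, ∑ i, W k i j = 1
  diag : ∀ k i, ν ≤ W k i i
  le_transition : ∀ k i j, ν ^ T ≤ transition W k T i j

theorem transition_nonneg {W : ℕ → Matrix V V ℝ} (hW : ∀ k i j, 0 ≤ W k i j) (k t : ℕ)
    (i j : V) : 0 ≤ transition W k t i j := by
  induction t generalizing i with
  | zero =>
    rw [transition, Matrix.one_apply]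
    split_ifs <;> norm_num
  | succ t ih =>
    rw [transition_succ_apply]
    exact Finset.sum_nonneg fun l _ => mul_nonneg (hW _ _ _) (ih l)

/-- Compliant weights on a time-varying graph whose windows are strongly connected are mixing. -/
theorem IsMixing.of_isQStronglyConnected {W : ℕ → Matrix V V ℝ} {ν : ℝ} (hν : 0 < ν)
    {G : ℕ → Digraph V} (hW : ∀ k, IsCompliant (G k) (W k)) (hloop : ∀ k i, (G k).Adj i i)
    (hcol : ∀ k j, ∑ i, W k i j = 1) (hWν : ∀ k i j, (G k).Adj j i → ν ≤ W k i j)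
    {Q : ℕ} (hQ : 0 < Q) (hG : IsQStronglyConnected Q G) :
    IsMixing W ν ((Fintype.card V + 1) * Q) := by
  have hn : ∀ k i j, 0 ≤ W k i j := by
    intro k i j
    by_cases h : (G k).Adj j i
    · exact ((hW k i j).1 h).le
    · exact ((hW k i j).2 h).ge
  refine ⟨hν, hn, hcol, fun k i => hWν k i i (hloop k i), fun k i j => ?_⟩
  -- The informed set consists of the rows whose entry in column `j` has stayed above the power of
  -- `ν`; it starts with `j`, as the empty product is the identity.
  have huniv := eq_univ_of_isQStronglyConnected hQ hG hloop (k := k)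
    (S := fun t => Finset.univ.filter fun i => ν ^ (t - k) ≤ transition W k (t - k) i j)
    ⟨j, by simp [transition]⟩ (by
      intro t ht a c ha hac
      simp only [Finset.mem_filter, Finset.mem_univ, true_and] at ha ⊢
      obtain ⟨s, rfl⟩ := Nat.exists_eq_add_of_le ht
      rw [add_assoc]
      simp only [Nat.add_sub_cancel_left] at ha ⊢
      rw [transition_succ_apply, pow_succ']
      calc ν * ν ^ s ≤ W (k + s) c a * transition W k s a j :=
            mul_le_mul (hWν _ _ _ hac) ha (pow_nonneg hν.le s) (hn _ _ _)
        _ ≤ _ := Finset.single_le_sum (f := fun l => W (k + s) c l * transition W k s l j)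
            (fun l _ => mul_nonneg (hn _ _ _) (transition_nonneg hn k s l j))
            (Finset.mem_univ a))
  have := (Finset.eq_univ_iff_forall.1 huniv) i
  simpa using this

end Mixing

/-! ### Diameter of a finite family and convex combinations -/

section Diameter

variable {V X : Type*} [NormedAddCommGroup X]

/-- The diameter of a finite family of vectors. -/
noncomputable def famDiam (u : V → X) : ℝ := ⨆ p : V × V, ‖u p.1 - u p.2‖

theorem norm_sub_le_famDiam [Finite V] (u : V → X) (i j : V) : ‖u i - u j‖ ≤ famDiam u :=
  le_ciSup (f := fun p : V × V => ‖u p.1 - u p.2‖) (Set.finite_range _).bddAbove (i, j)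

theorem famDiam_nonneg (u : V → X) : 0 ≤ famDiam u :=
  Real.iSup_nonneg fun _ => norm_nonneg _

theorem famDiam_le [Nonempty V] {u : V → X} {c : ℝ} (h : ∀ i j, ‖u i - u j‖ ≤ c) :
    famDiam u ≤ c :=
  ciSup_le fun p => h p.1 p.2

variable [Fintype V] [NormedSpace ℝ X]

/-- Two convex combinations of a family, one of them with all weights at least `ε`, are at
distance at most `1 - ε` times the diameter. -/
theorem norm_sum_smul_sub_sum_smul_le {α β : V → ℝ} {ε : ℝ} (hα : ∀ i, 0 ≤ α i)
    (hα1 : ∑ i, α i = 1) (hβ0 : ∀ i, 0 ≤ β i) (hβ : ∀ i, ε ≤ β i) (hβ1 : ∑ i, β i = 1)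
    (u : V → X) :
    ‖∑ i, α i • u i - ∑ i, β i • u i‖ ≤ (1 - ε) * famDiam u := by
  classical
  -- The term `i = l` vanishes and carries weight at least `ε`.
  have hpt : ∀ l, ‖u l - ∑ i, β i • u i‖ ≤ (1 - ε) * famDiam u := by
    intro l
    have h1 : u l - ∑ i, β i • u i = ∑ i ∈ Finset.univ.erase l, β i • (u l - u i) := by
      rw [Finset.sum_erase _ (by simp)]
      simp only [smul_sub, Finset.sum_sub_distrib, ← Finset.sum_smul, hβ1, one_smul]
    have h2 : ∑ i ∈ Finset.univ.erase l, β i = 1 - β l := by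
      rw [← hβ1, ← Finset.add_sum_erase _ _ (Finset.mem_univ l)]; ring
    rw [h1]
    calc _ ≤ ∑ i ∈ Finset.univ.erase l, ‖β i • (u l - u i)‖ := norm_sum_le _ _
      _ ≤ ∑ i ∈ Finset.univ.erase l, β i * famDiam u := by
          refine Finset.sum_le_sum fun i _ => ?_
          rw [norm_smul, Real.norm_of_nonneg (hβ0 i)]
          exact mul_le_mul_of_nonneg_left (norm_sub_le_famDiam u l i) (hβ0 i)
      _ = (1 - β l) * famDiam u := by rw [← Finset.sum_mul, h2]
      _ ≤ _ := mul_le_mul_of_nonneg_right (by linarith [hβ l]) (famDiam_nonneg u)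
  have h1 : ∑ i, α i • u i - ∑ i, β i • u i = ∑ l, α l • (u l - ∑ i, β i • u i) := by
    simp only [smul_sub, Finset.sum_sub_distrib]
    rw [← Finset.sum_smul (f := α), hα1, one_smul]
  rw [h1]
  calc _ ≤ ∑ l, ‖α l • (u l - ∑ i, β i • u i)‖ := norm_sum_le _ _
    _ ≤ ∑ l, α l * ((1 - ε) * famDiam u) := by
        refine Finset.sum_le_sum fun l _ => ?_
        rw [norm_smul, Real.norm_of_nonneg (hα l)]
        exact mul_le_mul_of_nonneg_left (hpt l) (hα l)
    _ = _ := by rw [← Finset.sum_mul, hα1, one_mul]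

end Diameter

/-! ### Perturbed push-sum averaging -/

section Averaging

variable {V X : Type*} [Fintype V]

/-- Column-stochastic weights preserve total mass. -/
theorem sum_eq_card_of_pushSum {W : ℕ → Matrix V V ℝ} (hcol : ∀ k j, ∑ i, W k i j = 1)
    {q : ℕ → V → ℝ} (hq0 : ∀ i, q 0 i = 1) (hq : ∀ k i, q (k + 1) i = ∑ j, W k i j * q k j)
    (k : ℕ) : ∑ i, q k i = Fintype.card V := by
  induction k with
  | zero => simp [hq0]
  | succ k ih =>
    simp only [hq]
    rw [Finset.sum_comm]
    simp only [← Finset.sum_mul, hcol, one_mul, ih]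

variable [DecidableEq V]

theorem eq_sum_transition {W : ℕ → Matrix V V ℝ}
    {q : ℕ → V → ℝ} (hq : ∀ k i, q (k + 1) i = ∑ j, W k i j * q k j) (k t : ℕ) (i : V) :
    q (k + t) i = ∑ j, transition W k t i j * q k j := by
  induction t generalizing i with
  | zero => simp [transition, Matrix.one_apply]
  | succ t ih =>
    rw [← add_assoc, hq]
    simp only [ih, transition_succ_apply, Finset.mul_sum, Finset.sum_mul]
    rw [Finset.sum_comm]
    simp only [mul_assoc]

variable {W : ℕ → Matrix V V ℝ} {ν : ℝ} {T : ℕ} {q : ℕ → V → ℝ}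

theorem pushSum_nonneg (hW : IsMixing W ν T)
    (hq0 : ∀ i, q 0 i = 1) (hq : ∀ k i, q (k + 1) i = ∑ j, W k i j * q k j)
    (k : ℕ) (i : V) : 0 ≤ q k i := by
  induction k generalizing i with
  | zero => simp [hq0]
  | succ k ih =>
    rw [hq]
    exact Finset.sum_nonneg fun j _ => mul_nonneg (hW.nonneg k i j) (ih j)

theorem IsMixing.le_one [Nonempty V] (hW : IsMixing W ν T) : ν ≤ 1 := by
  obtain ⟨i⟩ := ‹Nonempty V›
  rw [← hW.col 0 i]
  exact (hW.diag 0 i).trans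
    (Finset.single_le_sum (f := fun l => W 0 l i) (fun l _ => hW.nonneg 0 l i)
      (Finset.mem_univ i))

/-- The push-sum weights stay bounded away from zero. -/
theorem pow_le_pushSum [Nonempty V] (hW : IsMixing W ν T)
    (hq0 : ∀ i, q 0 i = 1) (hq : ∀ k i, q (k + 1) i = ∑ j, W k i j * q k j)
    (k : ℕ) (i : V) : ν ^ T ≤ q k i := by
  have hn := pushSum_nonneg hW hq0 hq
  -- From time `T` on, mixing spreads the total mass over all vertices; before that, self-loops
  -- alone keep a fraction `ν` per step.
  rcases le_total T k with h | h
  · obtain ⟨s, rfl⟩ := Nat.exists_eq_add_of_le' h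
    rw [eq_sum_transition hq]
    calc ν ^ T ≤ ν ^ T * Fintype.card V :=
          le_mul_of_one_le_right (pow_nonneg hW.pos.le T) (by exact_mod_cast Fintype.card_pos)
      _ = ∑ j, ν ^ T * q s j := by
          rw [← Finset.mul_sum, sum_eq_card_of_pushSum hW.col hq0 hq]
      _ ≤ _ := Finset.sum_le_sum fun j _ =>
          mul_le_mul_of_nonneg_right (hW.le_transition s i j) (hn s j)
  · have hk : ν ^ k ≤ q k i := by
      clear h
      induction k with
      | zero => simp [hq0]
      | succ k ih =>
        rw [hq, pow_succ']
        calc ν * ν ^ k ≤ W k i i * q k i :=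
              mul_le_mul (hW.diag k i) ih (pow_nonneg hW.pos.le k) (hW.nonneg _ _ _)
          _ ≤ _ := Finset.single_le_sum (f := fun j => W k i j * q k j)
              (fun j _ => mul_nonneg (hW.nonneg k i j) (hn k j)) (Finset.mem_univ i)
    exact (pow_le_pow_of_le_one hW.pos.le hW.le_one h).trans hk

variable [NormedAddCommGroup X] [NormedSpace ℝ X]

/-- Deviation of the perturbed recursion from the unperturbed one. -/
theorem sum_norm_sub_transition_le (hn : ∀ k i j, 0 ≤ W k i j) (hcol : ∀ k j, ∑ i, W k i j = 1)
    {z e : ℕ → V → X} (hz : ∀ k i, z (k + 1) i = ∑ j, W k i j • z k j - e k i)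
    {c : ℕ → ℝ} (hc : Antitone c) (he : ∀ k i, ‖e k i‖ ≤ c k) (k t : ℕ) :
    ∑ i, ‖z (k + t) i - ∑ j, transition W k t i j • z k j‖ ≤ t * (Fintype.card V * c k) := by
  induction t with
  | zero => simp [transition, Matrix.one_apply]
  | succ t ih =>
    have h1 : ∀ i, z (k + (t + 1)) i - ∑ j, transition W k (t + 1) i j • z k j =
        ∑ l, W (k + t) i l • (z (k + t) l - ∑ j, transition W k t l j • z k j)
          - e (k + t) i := by
      intro i
      rw [← add_assoc, hz]
      simp only [transition_succ_apply, Finset.sum_smul, smul_sub, Finset.sum_sub_distrib,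
        Finset.smul_sum, smul_smul]
      rw [Finset.sum_comm (f := fun j l => (W (k + t) i l * transition W k t l j) • z k j)]
      abel
    -- Rows need not sum to one, so the error is measured by its sum over vertices, which
    -- column-stochastic weights do not increase.
    calc _ ≤ ∑ i, (∑ l, W (k + t) i l * ‖z (k + t) l - ∑ j, transition W k t l j • z k j‖
            + c k) := by
          refine Finset.sum_le_sum fun i _ => ?_
          rw [h1]
          refine (norm_sub_le _ _).trans (add_le_add ((norm_sum_le _ _).trans ?_)
            ((he _ _).trans (hc (Nat.le_add_right k t))))
          refine Finset.sum_le_sum fun l _ => ?_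
          rw [norm_smul, Real.norm_of_nonneg (hn _ _ _)]
      _ = ∑ l, ‖z (k + t) l - ∑ j, transition W k t l j • z k j‖ + Fintype.card V * c k := by
          rw [Finset.sum_add_distrib, Finset.sum_comm]
          simp only [← Finset.sum_mul, hcol, one_mul, Finset.sum_const, Finset.card_univ,
            nsmul_eq_mul]
      _ ≤ _ := by push_cast; linarith

/-- Perturbed push-sum averaging: the ratios `w / q` are within a square-summable distance of the
average of `z`. -/
theorem exists_summable_sq_norm_sub_average_le [Nonempty V] (hW : IsMixing W ν T)
    (hq0 : ∀ i, q 0 i = 1) (hq : ∀ k i, q (k + 1) i = ∑ j, W k i j * q k j)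
    {z e : ℕ → V → X} (hz : ∀ k i, z (k + 1) i = ∑ j, W k i j • z k j - e k i)
    {c : ℕ → ℝ} (hc : Antitone c) (hcs : Summable fun k => c k ^ 2)
    (he : ∀ k i, ‖e k i‖ ≤ c k) :
    ∃ d : ℕ → ℝ, (∀ k, 0 ≤ d k) ∧ (Summable fun k => d k ^ 2) ∧
      ∀ k i, ‖(q (k + 1) i)⁻¹ • ∑ j, W k i j • z k j
        - (Fintype.card V : ℝ)⁻¹ • ∑ j, z k j‖ ≤ d k := by
  set N : ℝ := (Fintype.card V : ℝ) with hN
  have hNpos : 0 < N := by rw [hN]; exact_mod_cast Fintype.card_pos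
  have hsum := sum_eq_card_of_pushSum hW.col hq0 hq
  have hlow := pow_le_pushSum hW hq0 hq
  set δ : ℝ := ν ^ T with hδ
  have hδpos : 0 < δ := pow_pos hW.pos T
  have hqpos : ∀ k i, 0 < q k i := fun k i => hδpos.trans_le (hlow k i)
  have hqN : ∀ k i, q k i ≤ N := fun k i => by
    rw [hN, ← hsum k]
    exact Finset.single_le_sum (fun j _ => (hqpos k j).le) (Finset.mem_univ i)
  let u : ℕ → V → X := fun k i => (q k i)⁻¹ • z k i
  have hu : ∀ k i, z k i = q k i • u k i := fun k i =>
    (smul_inv_smul₀ (hqpos k i).ne' _).symm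
  refine ⟨fun k => famDiam (u k), fun k => famDiam_nonneg _, ?_, fun k i => ?_⟩
  · have hδN : δ ≤ N := (hlow 0 (Classical.arbitrary V)).trans (hqN 0 _)
    have hδ1 : δ ≤ 1 := pow_le_one₀ hW.pos.le hW.le_one
    have hε1 : δ * δ / N ≤ 1 := by
      rw [div_le_one hNpos]
      nlinarith
    refine summable_sq_of_contraction (T := T) (ε := δ * δ / N)
      (b := fun k => 2 * T * N / δ * c k) (by positivity) hε1 (fun k => famDiam_nonneg _) ?_
      fun k => ?_
    · simp only [mul_pow]
      exact hcs.mul_left _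
    -- Row-stochastic because `q` is propagated by the same transition matrix. The bound `δ * δ / N`
    -- combines a transition entry and a mass, both at least `δ`, with a denominator at most `N`.
    let α : V → V → ℝ := fun i j => (q (k + T) i)⁻¹ * (transition W k T i j * q k j)
    let r : V → X := fun i => z (k + T) i - ∑ j, transition W k T i j • z k j
    have hα0 : ∀ i j, 0 ≤ α i j := fun i j =>
      mul_nonneg (inv_nonneg.2 (hqpos _ _).le)
        (mul_nonneg (transition_nonneg hW.nonneg _ _ _ _) (hqpos _ _).le)
    have hα1 : ∀ i, ∑ j, α i j = 1 := fun i => by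
      simp only [α]
      rw [← Finset.mul_sum, ← eq_sum_transition hq, inv_mul_cancel₀ (hqpos _ _).ne']
    have hαε : ∀ i j, δ * δ / N ≤ α i j := fun i j => by
      simp only [α]
      rw [div_eq_inv_mul]
      exact mul_le_mul (inv_anti₀ (hqpos _ _) (hqN _ _))
        (mul_le_mul (hW.le_transition _ _ _) (hlow _ _) hδpos.le
          (transition_nonneg hW.nonneg _ _ _ _)) (by positivity) (inv_nonneg.2 (hqpos _ _).le)
    have hur : ∀ i, u (k + T) i = ∑ j, α i j • u k j + (q (k + T) i)⁻¹ • r i := by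
      intro i
      simp only [u, r, α, smul_sub, mul_smul, ← Finset.smul_sum]
      simp only [smul_inv_smul₀ (hqpos k _).ne']
      abel
    have hr : ∀ i, ‖(q (k + T) i)⁻¹ • r i‖ ≤ δ⁻¹ * (T * (N * c k)) := by
      intro i
      rw [norm_smul, norm_inv, Real.norm_of_nonneg (hqpos _ _).le]
      refine mul_le_mul (inv_anti₀ hδpos (hlow _ _)) ?_ (norm_nonneg _) (by positivity)
      exact (Finset.single_le_sum (f := fun i => ‖r i‖) (fun j _ => norm_nonneg _)
        (Finset.mem_univ i)).trans (sum_norm_sub_transition_le hW.nonneg hW.col hz hc he k T)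
    refine famDiam_le fun i j => ?_
    rw [hur, hur, add_sub_add_comm]
    refine (norm_add_le _ _).trans (add_le_add
      (norm_sum_smul_sub_sum_smul_le (hα0 i) (hα1 i) (hα0 j) (hαε j) (hα1 j) (u k)) ?_)
    refine (norm_sub_le _ _).trans ((add_le_add (hr i) (hr j)).trans (le_of_eq ?_))
    field_simp
    ring
  · have h1 : (q (k + 1) i)⁻¹ • ∑ j, W k i j • z k j =
        ∑ j, ((q (k + 1) i)⁻¹ * (W k i j * q k j)) • u k j := by
      simp only [hu k, mul_smul, Finset.smul_sum]
    have h2 : N⁻¹ • ∑ j, z k j = ∑ j, (N⁻¹ * q k j) • u k j := by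
      simp only [hu k, mul_smul, Finset.smul_sum]
    rw [h1, h2]
    -- The new ratio and the average are both convex combinations of `u k`; no contraction is
    -- needed, hence `ε = 0`.
    refine (norm_sum_smul_sub_sum_smul_le (ε := 0) ?_ ?_ ?_ ?_ ?_ (u k)).trans (by simp)
    · exact fun j => mul_nonneg (inv_nonneg.2 (hqpos _ _).le)
        (mul_nonneg (hW.nonneg _ _ _) (hqpos _ _).le)
    · rw [← Finset.mul_sum, ← hq, inv_mul_cancel₀ (hqpos _ _).ne']
    · exact fun j => mul_nonneg (inv_nonneg.2 hNpos.le) (hqpos _ _).le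
    · exact fun j => mul_nonneg (inv_nonneg.2 hNpos.le) (hqpos _ _).le
    · rw [← Finset.mul_sum, hsum, inv_mul_cancel₀ hNpos.ne']

end Averaging

end PushSum

namespace PushSum

/-! ### Extension by zero -/

section Extension

variable {π : Type*} {n : π → ℕ} {S : Finset π}

theorem Var.restrict_add (x y : Var n) :
    Var.restrict S (x + y) = Var.restrict S x + Var.restrict S y := rfl

theorem Var.restrict_sub (x y : Var n) :
    Var.restrict S (x - y) = Var.restrict S x - Var.restrict S y := rfl

theorem SubVar.norm_le_sum (x : SubVar n S) : ‖x‖ ≤ ∑ p, ‖x p‖ := by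
  rw [PiLp.norm_eq_of_L2]
  exact Real.sqrt_le_iff.2 ⟨Finset.sum_nonneg fun p _ => norm_nonneg _,
    Finset.sum_sq_le_sq_sum_of_nonneg fun p _ => norm_nonneg _⟩

variable [DecidableEq π]

/-- The full variable with components `x` in `S` and zero elsewhere. -/
noncomputable def SubVar.extend (x : SubVar n S) : Var n :=
  WithLp.toLp 2 fun p => if h : p ∈ S then x ⟨p, h⟩ else 0

theorem SubVar.restrict_extend (x : SubVar n S) : Var.restrict S x.extend = x := by
  ext p : 1
  simp [Var.restrict, SubVar.extend]

variable [Fintype π]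

/-- Extension is the adjoint of restriction, which makes it isometric and lets it transport
subgradients. -/
theorem SubVar.inner_extend (x : SubVar n S) (y : Var n) :
    inner ℝ x.extend y = inner ℝ x (Var.restrict S y) := by
  rw [PiLp.inner_apply, PiLp.inner_apply, ← Finset.sum_subset (Finset.subset_univ S),
    ← Finset.sum_coe_sort S]
  · refine Finset.sum_congr rfl fun p _ => ?_
    simp [SubVar.extend, Var.restrict]
  · intro p _ hp
    simp [SubVar.extend, hp]

theorem SubVar.norm_extend (x : SubVar n S) : ‖x.extend‖ = ‖x‖ := by
  rw [norm_eq_sqrt_real_inner, norm_eq_sqrt_real_inner, SubVar.inner_extend,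
    SubVar.restrict_extend]

end Extension

/-! ### Subgradients of the agents' costs -/

section Costs

variable {π ι : Type*} [Fintype π] [DecidableEq π] [DecidableEq ι]
variable {n : π → ℕ} {Intf E : Finset (π × ι)} {f : ∀ i : ι, SubVar n (inNbr Intf i) → ℝ}

theorem estCost_restrict (hE : Intf ⊆ E) (i : ι) (y : Var n) :
    estCost f hE i (y.restrict (inNbr E i)) = fullCost f i y := rfl

theorem continuous_totalCost [Fintype ι] (hconv : ∀ i, ConvexOn ℝ Set.univ (fullCost f i)) :
    Continuous (totalCost f) :=
  continuous_finsetSum _ fun i _ => (hconv i).locallyLipschitz.continuous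

/-- The cost factors through restriction, whose adjoint is extension. This carries the bound `L`,
assumed on the full space, over to the subgradients used by the agents. -/
theorem extend_mem_subdifferential {hE : Intf ⊆ E} {i : ι} {x g : SubVar n (inNbr E i)}
    (hg : g ∈ subdifferential (estCost f hE i) x) :
    g.extend ∈ subdifferential (fullCost f i) x.extend := by
  intro y
  rw [SubVar.inner_extend, Var.restrict_sub, SubVar.restrict_extend, ← estCost_restrict hE,
    ← estCost_restrict hE, SubVar.restrict_extend]
  exact hg _

theorem norm_le_of_mem_subdifferential_estCost {L : ℝ}
    (hfL : ∀ i, ∀ y : Var n, ∀ g ∈ subdifferential (fullCost f i) y, ‖g‖ ≤ L)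
    {hE : Intf ⊆ E} {i : ι}
    {x g : SubVar n (inNbr E i)} (hg : g ∈ subdifferential (estCost f hE i) x) : ‖g‖ ≤ L := by
  rw [← SubVar.norm_extend]
  exact hfL i _ _ (extend_mem_subdifferential hg)

/-- Bounded subgradients make the cost Lipschitz; a subgradient at `a` exists by convexity. -/
theorem fullCost_sub_le {L : ℝ}
    (hfL : ∀ i, ∀ y : Var n, ∀ g ∈ subdifferential (fullCost f i) y, ‖g‖ ≤ L)
    (hconv : ∀ i, ConvexOn ℝ Set.univ (fullCost f i)) (i : ι)
    (a b : Var n) : fullCost f i a - L * ‖b - a‖ ≤ fullCost f i b := by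
  obtain ⟨v, hv⟩ := subdifferential_nonempty (hconv i)
    (hconv i).locallyLipschitz.continuous a
  have h1 := hv b
  have h2 := (abs_le.1 (abs_real_inner_le_norm v (b - a))).1
  have h3 := mul_le_mul_of_nonneg_right (hfL i a v hv) (norm_nonneg (b - a))
  linarith

/-- A subgradient at a nearby point is an approximate subgradient. -/
theorem fullCost_sub_fullCost_le {L : ℝ}
    (hfL : ∀ i, ∀ y : Var n, ∀ g ∈ subdifferential (fullCost f i) y, ‖g‖ ≤ L)
    (hconv : ∀ i, ConvexOn ℝ Set.univ (fullCost f i))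
    {hE : Intf ⊆ E} {i : ι} {x g : SubVar n (inNbr E i)}
    (hg : g ∈ subdifferential (estCost f hE i) x) (a c : Var n) :
    fullCost f i a - fullCost f i c - 2 * L * ‖x - a.restrict (inNbr E i)‖ ≤
      inner ℝ g ((a - c).restrict (inNbr E i)) := by
  set a' := a.restrict (inNbr E i)
  set c' := c.restrict (inNbr E i)
  have h1 : estCost f hE i x + inner ℝ g (c' - x) ≤ fullCost f i c := hg _
  -- The test point agrees with `x` on the components of agent `i` and with `a` elsewhere. One `L`
  -- comes from moving the cost here, the other from Cauchy–Schwarz in `h3`.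
  have h2 := fullCost_sub_le hfL hconv i a (a + (x - a').extend)
  rw [← estCost_restrict hE, ← estCost_restrict hE, Var.restrict_add, SubVar.restrict_extend,
    add_sub_cancel_left, SubVar.norm_extend, estCost_restrict, add_sub_cancel] at h2
  have h3 := (abs_le.1 (abs_real_inner_le_norm g (x - a'))).2
  have h4 := mul_le_mul_of_nonneg_right (norm_le_of_mem_subdifferential_estCost hfL hg)
    (norm_nonneg (x - a'))
  have h5 : inner ℝ g ((a - c).restrict (inNbr E i)) =
      -inner ℝ g (c' - x) - inner ℝ g (x - a') := by
    rw [Var.restrict_sub, ← inner_neg_right, ← inner_sub_right]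
    congr 1
    abel
  rw [h5]
  linarith

end Costs

/-! ### Convergence of the push-sum subgradient method -/

section Convergence

variable {π ι : Type*} [Fintype π] [DecidableEq π] [Fintype ι] [DecidableEq ι]
variable {n : π → ℕ} {E : Finset (π × ι)}

/-- Both sides run over the edges of `E`: averaging works component by component, subgradients agent
by agent. -/
theorem sum_outNbr_comm (F : ∀ p : π, {i : ι // i ∈ outNbr E p} → ℝ) :
    ∑ p, ∑ i, F p i =
      ∑ i, ∑ p : {p // p ∈ inNbr E i}, F p ⟨i, mem_outNbr_iff_mem_inNbr.2 p.2⟩ := by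
  rw [← Fintype.sum_sigma', ← Fintype.sum_sigma']
  refine Fintype.sum_equiv
    ⟨fun x => ⟨x.2.1, x.1, mem_outNbr_iff_mem_inNbr.1 x.2.2⟩,
      fun x => ⟨x.2.1, x.1, mem_outNbr_iff_mem_inNbr.2 x.2.2⟩, fun _ => rfl, fun _ => rfl⟩
    _ _ fun _ => rfl

/-- The average of the copies of each component. -/
noncomputable def Copies.average (x : Copies n E) : Var n :=
  WithLp.toLp 2 fun p => (Fintype.card {i : ι // i ∈ outNbr E p} : ℝ)⁻¹ • ∑ i, x p i

/-- The squared distance in which each component is weighted by the number of its copies. -/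
noncomputable def copiesDistSq (E : Finset (π × ι)) (c x : Var n) : ℝ :=
  ∑ p, (Fintype.card {i : ι // i ∈ outNbr E p} : ℝ) * ‖x p - c p‖ ^ 2

theorem norm_sub_sq_le_copiesDistSq (hne : ∀ p, Nonempty {i : ι // i ∈ outNbr E p})
    (c x : Var n) : ‖x - c‖ ^ 2 ≤ copiesDistSq E c x := by
  rw [PiLp.norm_sq_eq_of_L2]
  refine Finset.sum_le_sum fun p _ => ?_
  have := hne p
  exact le_mul_of_one_le_left (sq_nonneg _) (by exact_mod_cast Fintype.card_pos)

theorem continuous_copiesDistSq (c : Var n) : Continuous (copiesDistSq E c) := by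
  unfold copiesDistSq
  fun_prop

/-- A subgradient step on the averages. -/
theorem copiesDistSq_le (hne : ∀ p, Nonempty {i : ι // i ∈ outNbr E p}) {g : Copies n E}
    {L γ : ℝ} (hg : ∀ p i, ‖g p i‖ ≤ L) {a a' : Var n}
    (ha : ∀ p, a' p = a p -
      γ • (Fintype.card {i : ι // i ∈ outNbr E p} : ℝ)⁻¹ • ∑ i, g p i) (c : Var n) :
    copiesDistSq E c a' ≤ copiesDistSq E c a
      - 2 * γ * ∑ i, inner ℝ (g.agent i) ((a - c).restrict (inNbr E i))
      + γ ^ 2 * ∑ p, (Fintype.card {i : ι // i ∈ outNbr E p} : ℝ) * L ^ 2 := by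
  have hswap : ∑ i, inner ℝ (g.agent i) ((a - c).restrict (inNbr E i)) =
      ∑ p, inner ℝ (∑ i, g p i) (a p - c p) := by
    simp only [sum_inner]
    rw [sum_outNbr_comm fun p i => inner ℝ (g p i) (a p - c p)]
    rfl
  rw [hswap]
  simp only [copiesDistSq]
  rw [Finset.mul_sum, Finset.mul_sum, ← Finset.sum_sub_distrib, ← Finset.sum_add_distrib]
  refine Finset.sum_le_sum fun p _ => ?_
  have := hne p
  have hN : (0 : ℝ) < Fintype.card {i : ι // i ∈ outNbr E p} := by
    exact_mod_cast Fintype.card_pos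
  set N : ℝ := (Fintype.card {i : ι // i ∈ outNbr E p} : ℝ) with hNdef
  have hG : ‖∑ i, g p i‖ ≤ N * L := by
    refine (norm_sum_le_of_le _ fun i _ => hg p i).trans (le_of_eq ?_)
    rw [Finset.sum_const, Finset.card_univ, nsmul_eq_mul]
  -- The weight `N` will cancel `N⁻¹` in the cross term, so that every subgradient enters with the
  -- same coefficient.
  have h1 : a' p - c p = (a p - c p) - (γ * N⁻¹) • ∑ i, g p i := by
    rw [ha, mul_smul]; abel
  rw [h1, norm_sub_sq_real, norm_smul, mul_pow, inner_smul_right, real_inner_comm, Real.norm_eq_abs,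
    sq_abs]
  have h2 : ‖∑ i, g p i‖ ^ 2 ≤ (N * L) ^ 2 := pow_le_pow_left₀ (norm_nonneg _) hG 2
  have h3 : N * ((γ * N⁻¹) ^ 2 * ‖∑ i, g p i‖ ^ 2) ≤ γ ^ 2 * (N * L ^ 2) := by
    calc _ ≤ N * ((γ * N⁻¹) ^ 2 * (N * L) ^ 2) :=
          mul_le_mul_of_nonneg_left (mul_le_mul_of_nonneg_left h2 (sq_nonneg _)) hN.le
      _ = _ := by field_simp
  have h4 : N * (2 * (γ * N⁻¹ * inner ℝ (∑ i, g p i) (a p - c p))) =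
      2 * γ * inner ℝ (∑ i, g p i) (a p - c p) := by field_simp
  linarith

theorem norm_agent_sub_le (x : Copies n E) (a : Var n) {d : π → ℝ}
    (hd : ∀ p i, ‖x p i - a p‖ ≤ d p) :
    ∑ i, ‖x.agent i - a.restrict (inNbr E i)‖ ≤
      ∑ p, (Fintype.card {i : ι // i ∈ outNbr E p} : ℝ) * d p := by
  have h1 : ∀ i, ‖x.agent i - a.restrict (inNbr E i)‖ ≤ ∑ p : {p // p ∈ inNbr E i},
      ‖x p ⟨i, mem_outNbr_iff_mem_inNbr.2 p.2⟩ - a p‖ := fun i =>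
    SubVar.norm_le_sum (x.agent i - a.restrict (inNbr E i))
  refine (Finset.sum_le_sum fun i _ => h1 i).trans ?_
  rw [← sum_outNbr_comm fun p i => ‖x p i - a p‖]
  refine Finset.sum_le_sum fun p _ => (Finset.sum_le_sum fun i _ => hd p i).trans (le_of_eq ?_)
  rw [Finset.sum_const, Finset.card_univ, nsmul_eq_mul]

end Convergence

end PushSum

/-! ### Proof of convergence -/

theorem theorem4 {π ι : Type*} [Fintype π] [DecidableEq π] [Fintype ι] [DecidableEq ι]
    -- dimensions of the components, interference graph, estimate graph
    (n : π → ℕ) (Intf E : Finset (π × ι))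
    (hIntf : ∀ p : π, (PushSum.outNbr Intf p).Nonempty) (hE : Intf ⊆ E)
    -- communication graphs, design graphs (contained in the former) and their weights
    (C : ℕ → Digraph ι)
    (D : ℕ → ∀ p : π, Digraph {i : ι // i ∈ PushSum.outNbr E p})
    (hDC : ∀ (k : ℕ) (p : π) (i j : {i : ι // i ∈ PushSum.outNbr E p}),
      (D k p).Adj i j → (C k).Adj i j)
    (W : ℕ → ∀ p : π,
      Matrix {i : ι // i ∈ PushSum.outNbr E p} {i : ι // i ∈ PushSum.outNbr E p} ℝ)
    (hW : ∀ k p, PushSum.IsCompliant (D k p) (W k p))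
    -- self-loops, column-stochasticity, weights bounded below
    (hloop : ∀ k p i, (D k p).Adj i i)
    (hcol : ∀ k p j, ∑ i, W k p i j = 1)
    (ν : ℝ) (hν : 0 < ν) (hWν : ∀ k p i j, (D k p).Adj j i → ν ≤ W k p i j)
    -- strong connectivity over windows
    (Q : ℕ) (hQ : 0 < Q) (hD : ∀ p, PushSum.IsQStronglyConnected Q fun k => D k p)
    -- costs
    (f : ∀ i : ι, PushSum.SubVar n (PushSum.inNbr Intf i) → ℝ)
    (hsol : (PushSum.solutionSet f).Nonempty)
    (hconv : ∀ i, ConvexOn ℝ Set.univ (PushSum.fullCost f i))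
    (L : ℝ) (hL : 0 < L)
    (hfL : ∀ i, ∀ y : PushSum.Var n, ∀ g ∈ PushSum.subdifferential (PushSum.fullCost f i) y,
      ‖g‖ ≤ L)
    -- step sizes
    (γ : ℕ → ℝ) (hγpos : ∀ k, 0 < γ k) (hγanti : Antitone γ)
    (hγsum : ¬ Summable γ) (hγsq : Summable fun k => γ k ^ 2)
    -- any sequences generated by the algorithm
    (q : ℕ → ∀ p : π, {i : ι // i ∈ PushSum.outNbr E p} → ℝ)
    (w z y g : ℕ → PushSum.Copies n E)
    (hrun : PushSum.IsRun f hE W γ q w z y g) :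
    ∃ ystar ∈ PushSum.solutionSet f,
      Tendsto y atTop (𝓝 (PushSum.consensus E ystar)) := by
  have hne : ∀ p, Nonempty {i : ι // i ∈ PushSum.outNbr E p} := fun p => by
    obtain ⟨i, hi⟩ := hIntf p
    refine ⟨i, ?_⟩
    simp only [PushSum.outNbr, Finset.mem_filter, Finset.mem_univ, true_and] at hi ⊢
    exact hE hi
  have hgL : ∀ k i, ‖(g (k + 1)).agent i‖ ≤ L := fun k i =>
    PushSum.norm_le_of_mem_subdifferential_estCost hfL (hrun.g_succ k i)
  have hgL' : ∀ k p i, ‖g (k + 1) p i‖ ≤ L := fun k p i =>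
    (PiLp.norm_apply_le ((g (k + 1)).agent i)
      ⟨p, PushSum.mem_outNbr_iff_mem_inNbr.1 i.2⟩).trans (hgL k i)
  have hz : ∀ k p i, z (k + 1) p i = ∑ j, W k p i j • z k p j - γ k • g (k + 1) p i :=
    fun k p i => by rw [hrun.z_succ, hrun.w_succ]
  let a : ℕ → PushSum.Var n := fun k => (z k).average
  have hcons : ∀ p, ∃ d : ℕ → ℝ, (∀ k, 0 ≤ d k) ∧ (Summable fun k => d k ^ 2) ∧
      ∀ k i, ‖y (k + 1) p i - a k p‖ ≤ d k := by
    intro p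
    have := hne p
    obtain ⟨d, hd0, hds, hd⟩ := PushSum.exists_summable_sq_norm_sub_average_le
      (PushSum.IsMixing.of_isQStronglyConnected hν (fun k => hW k p) (fun k => hloop k p)
        (fun k => hcol k p) (fun k => hWν k p) hQ (hD p))
      (q := fun k => q k p) (hrun.q_zero p)
      (fun k => hrun.q_succ k p) (z := fun k => z k p) (e := fun k i => γ k • g (k + 1) p i)
      (fun k => hz k p)
      (c := fun k => γ k * L) (fun s t hst => mul_le_mul_of_nonneg_right (hγanti hst) hL.le)
      (by simp only [mul_pow]; exact hγsq.mul_right _) (fun k i => by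
        rw [norm_smul, Real.norm_of_nonneg (hγpos k).le]
        exact mul_le_mul_of_nonneg_left (hgL' k p i) (hγpos k).le)
    refine ⟨d, hd0, hds, fun k i => ?_⟩
    rw [hrun.y_succ, hrun.w_succ]
    exact hd k i
  choose d hd0 hds hd using hcons
  have hstep : ∀ k p, a (k + 1) p = a k p -
      γ k • (Fintype.card {i : ι // i ∈ PushSum.outNbr E p} : ℝ)⁻¹ • ∑ i, g (k + 1) p i := by
    intro k p
    have hsum : ∑ i, z (k + 1) p i = ∑ i, z k p i - γ k • ∑ i, g (k + 1) p i := by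
      simp only [hz, Finset.sum_sub_distrib, ← Finset.smul_sum]
      rw [Finset.sum_comm]
      simp only [← Finset.sum_smul, hcol, one_smul]
    simp only [a, PushSum.Copies.average]
    rw [hsum, smul_sub, smul_comm]
  -- The `4 * L` is the `2` of the expanded square times the `2 * L` of the approximate subgradient
  -- inequality.
  let b : ℕ → ℝ := fun k =>
    4 * L * ∑ p, (Fintype.card {i : ι // i ∈ PushSum.outNbr E p} : ℝ) * (γ k * d p k)
      + γ k ^ 2 * ∑ p, (Fintype.card {i : ι // i ∈ PushSum.outNbr E p} : ℝ) * L ^ 2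
  have hb : Summable b := by
    refine ((summable_sum fun p _ => Summable.mul_left _ ?_).mul_left _).add (hγsq.mul_right _)
    refine Summable.of_nonneg_of_le (fun k => mul_nonneg (hγpos k).le (hd0 p k)) (fun k => ?_)
      (hγsq.add (hds p))
    nlinarith [sq_nonneg (γ k - d p k), mul_nonneg (hγpos k).le (hd0 p k)]
  obtain ⟨c, hc, hlim⟩ := PushSum.exists_tendsto_minimizer
    (PushSum.continuous_totalCost hconv) (S := PushSum.solutionSet f) rfl hsol
    (V := PushSum.copiesDistSq E) PushSum.continuous_copiesDistSq
    (fun c => by simp [PushSum.copiesDistSq]) (PushSum.norm_sub_sq_le_copiesDistSq hne)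
    (x := a) hb (fun k => (hγpos k).le) hγsum (by
      intro c hc k
      have h1 := PushSum.copiesDistSq_le hne (hgL' k) (hstep k) c
      have h2 := Finset.sum_le_sum fun i (_ : i ∈ Finset.univ) =>
        PushSum.fullCost_sub_fullCost_le hfL hconv (hrun.g_succ k i) (a k) c
      rw [Finset.sum_sub_distrib, Finset.sum_sub_distrib, ← Finset.mul_sum] at h2
      have h3 := PushSum.norm_agent_sub_le (y (k + 1)) (a k) (fun p i => hd p k i)
      -- Minimality of `c` allows the decrease `2 * γ k` times this gap to be weakened to `γ k`
      -- times it.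
      have h4 : 0 ≤ PushSum.totalCost f (a k) - PushSum.totalCost f c := sub_nonneg.2 (hc _)
      have h5 := mul_le_mul_of_nonneg_left h3 (by positivity : 0 ≤ 2 * L)
      have h6 : PushSum.totalCost f (a k) - PushSum.totalCost f c - 2 * L *
          ∑ p, (Fintype.card {i : ι // i ∈ PushSum.outNbr E p} : ℝ) * d p k ≤
          ∑ i, inner ℝ ((g (k + 1)).agent i)
            ((a k - c).restrict (PushSum.inNbr E i)) := by
        simp only [PushSum.totalCost]
        linarith
      have h7 := mul_le_mul_of_nonneg_left h6 (hγpos k).le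
      have h8 := mul_nonneg (hγpos k).le h4
      have h9 : ∑ p, (Fintype.card {i : ι // i ∈ PushSum.outNbr E p} : ℝ) * (γ k * d p k) =
          γ k * ∑ p, (Fintype.card {i : ι // i ∈ PushSum.outNbr E p} : ℝ) * d p k := by
        rw [Finset.mul_sum]
        exact Finset.sum_congr rfl fun p _ => by ring
      simp only [b, h9]
      linarith)
  refine ⟨c, hc, ?_⟩
  -- The value `y 0` is unconstrained, and `y (k + 1)` is compared with the average at time `k`.
  rw [← tendsto_add_atTop_iff_nat 1, tendsto_pi_nhds]
  intro p
  rw [tendsto_pi_nhds]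
  intro i
  have hdp : Tendsto (d p) atTop (𝓝 0) := by
    have h := (hds p).tendsto_atTop_zero.sqrt
    simpa [Real.sqrt_sq (hd0 p _)] using h
  have h1 : Tendsto (fun k => y (k + 1) p i - a k p) atTop (𝓝 0) :=
    squeeze_zero_norm (fun k => hd p k i) hdp
  have h2 : Tendsto (fun k => a k p) atTop (𝓝 (c p)) :=
    ((PiLp.continuous_apply 2 _ p).tendsto c).comp hlim
  simpa [PushSum.consensus] using h1.add h2
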